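/- Let $\tau=\{P_1,\dots,P_k\}$ be a fixed finite non-empty vocabulary of unary predicate symbols ($|\tau|=k\ge 1$). First-order formulas over $\tau$ are in negation normal form: they are built from the literals $x=y$, $x\neq y$, $P(x)$, $\neg P(x)$ (with $P\in\tau$) by $\lor$, $\land$, $\exists x$, $\forall x$. The size of a formula is the number of its atomic formulas, conjunctions, disjunctions and quantifiers (negations are not counted). A $\tau$-model of size $n$ is a tuple $\mathfrak M=(\{1,\dots,n\},P_1^{\mathfrak M},\dots,P_k^{\mathfrak M})$ with $P_i^{\mathfrak M}\subseteq\{1,\dots,n\}$. A sentence $\varphi$ defines $\mathfrak M$ if, for all $\tau$-models $\mathfrak M'$ of size $n$, $\mathfrak M'\models\varphi$ if and only if $\mathfrak M'$ is isomorphic to $\mathfrak M$; the description complexity $C(\mathfrak M)$ is the least size of a sentence that defines $\mathfrak M$. Let $$\mathbb E_n[C]:=\frac1{2^{|\tau|n}}\sum_{\mathfrak M}C(\mathfrak M),$$ where the sum is over all $\tau$-models of size $n$, be the expected description complexity of a uniformly random $\tau$-model of size $n$. Then $$\mathbb E_n[C]\sim\frac{3n}{2^{|\tau|}}\qquad(n\to\infty),$$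 that is, the ratio of the two sides tends to $1$. -/

import Mathlib

open Filter Asymptotics

/-- First-order formulas in negation normal form over a monadic vocabulary `τ`, with variables
`x₀, x₁, …` indexed by `ℕ`. Negation occurs only in the literals `neq` and `npred`. -/
inductive FOFormula (τ : Type*) where
  | eq (x y : ℕ) : FOFormula τ
  | neq (x y : ℕ) : FOFormula τ
  | pred (P : τ) (x : ℕ) : FOFormula τ
  | npred (P : τ) (x : ℕ) : FOFormula τ
  | or (φ ψ : FOFormula τ) : FOFormula τ
  | and (φ ψ : FOFormula τ) : FOFormula τ
  | ex (x : ℕ) (φ : FOFormula τ) : FOFormula τ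
  | all (x : ℕ) (φ : FOFormula τ) : FOFormula τ

namespace FOFormula

variable {τ : Type*}

/-- The number of atomic formulas, conjunctions, disjunctions and quantifiers; negations are
not counted. -/
def size : FOFormula τ → ℕ
  | eq _ _ => 1
  | neq _ _ => 1
  | pred _ _ => 1
  | npred _ _ => 1
  | or φ ψ => φ.size + ψ.size + 1
  | and φ ψ => φ.size + ψ.size + 1
  | ex _ φ => φ.size + 1
  | all _ φ => φ.size + 1

/-- The free variables of a formula. -/
def freeVars : FOFormula τ → Finset ℕ
  | eq x y => {x, y}
  | neq x y => {x, y}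
  | pred _ x => {x}
  | npred _ x => {x}
  | or φ ψ => φ.freeVars ∪ ψ.freeVars
  | and φ ψ => φ.freeVars ∪ ψ.freeVars
  | ex x φ => φ.freeVars.erase x
  | all x φ => φ.freeVars.erase x

/-- A sentence is a formula without free variables. -/
def IsSentence (φ : FOFormula τ) : Prop := φ.freeVars = ∅

end FOFormula

/-- A `τ`-model of size `n`: a subset of the domain `Fin n` for each predicate of `τ`. -/
abbrev UnaryModel (τ : Type*) (n : ℕ) := τ → Finset (Fin n)

namespace UnaryModel

variable {τ : Type*} {n : ℕ}

/-- Truth of a formula in the model `M` under the partial interpretation `s` of the variables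
(`s x = none` means that `s` is undefined at `x`). -/
def Sat (M : UnaryModel τ n) : (ℕ → Option (Fin n)) → FOFormula τ → Prop
  | s, .eq x y => ∃ a b, s x = some a ∧ s y = some b ∧ a = b
  | s, .neq x y => ∃ a b, s x = some a ∧ s y = some b ∧ a ≠ b
  | s, .pred P x => ∃ a, s x = some a ∧ a ∈ M P
  | s, .npred P x => ∃ a, s x = some a ∧ a ∉ M P
  | s, .or φ ψ => M.Sat s φ ∨ M.Sat s ψ
  | s, .and φ ψ => M.Sat s φ ∧ M.Sat s ψ
  | s, .ex x φ => ∃ a, M.Sat (Function.update s x (some a)) φ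
  | s, .all x φ => ∀ a, M.Sat (Function.update s x (some a)) φ

/-- Truth of a sentence: evaluation under the empty interpretation. -/
def Models (M : UnaryModel τ n) (φ : FOFormula τ) : Prop := M.Sat (fun _ => none) φ

/-- Isomorphism of `τ`-models of size `n`. -/
def Iso (M N : UnaryModel τ n) : Prop :=
  ∃ e : Fin n ≃ Fin n, ∀ (P : τ) (a : Fin n), a ∈ M P ↔ e a ∈ N P

/-- The sentence `φ` defines `M`: among the `τ`-models of size `n`, it is true in exactly
those isomorphic to `M`. -/
def DefinedBy (M : UnaryModel τ n) (φ : FOFormula τ) : Prop :=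
  φ.IsSentence ∧ ∀ N : UnaryModel τ n, N.Models φ ↔ N.Iso M

/-- Description complexity: the least size of a sentence defining `M`. (Every `M` is defined by
some sentence when `τ` is finite, so the infimum is over a non-empty set.) -/
noncomputable def descriptionComplexity (M : UnaryModel τ n) : ℕ :=
  sInf {r | ∃ φ : FOFormula τ, M.DefinedBy φ ∧ φ.size = r}

end UnaryModel

/-- The expected description complexity of a uniformly random `τ`-model of size `n`. -/
noncomputable def expectedComplexity (τ : Type*) [Fintype τ] [DecidableEq τ] (n : ℕ) : ℝ :=
  1 / 2 ^ (Fintype.card τ * n) * ∑ M : UnaryModel τ n, (M.descriptionComplexity : ℝ)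

set_option linter.unusedSectionVars false

namespace FOFormula

variable {τ : Type*}

/-- The number of equality literals. -/
def eqCount : FOFormula τ → ℕ
  | eq _ _ => 1
  | neq _ _ => 1
  | pred _ _ => 0
  | npred _ _ => 0
  | or φ ψ => φ.eqCount + ψ.eqCount
  | and φ ψ => φ.eqCount + ψ.eqCount
  | ex _ φ => φ.eqCount
  | all _ φ => φ.eqCount

/-- The number of quantifiers. -/
def quantCount : FOFormula τ → ℕ
  | eq _ _ => 0
  | neq _ _ => 0
  | pred _ _ => 0
  | npred _ _ => 0
  | or φ ψ => φ.quantCount + ψ.quantCount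
  | and φ ψ => φ.quantCount + ψ.quantCount
  | ex _ φ => φ.quantCount + 1
  | all _ φ => φ.quantCount + 1

theorem two_mul_eqCount_add_quantCount_le (φ : FOFormula τ) :
    2 * φ.eqCount + φ.quantCount ≤ φ.size + 1 := by
  induction φ <;> simp only [eqCount, quantCount, size] <;> omega

/-- The span of the differences `e_x - e_y` over the equality literals between `x` and `y`, where
a quantifier over `x` cuts down to the vectors that vanish at `x`. -/
noncomputable def linkSpace : FOFormula τ → Submodule ℚ (ℕ →₀ ℚ)
  | eq x y => Submodule.span ℚ {Finsupp.single x 1 - Finsupp.single y 1}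
  | neq x y => Submodule.span ℚ {Finsupp.single x 1 - Finsupp.single y 1}
  | pred _ _ => ⊥
  | npred _ _ => ⊥
  | or φ ψ => φ.linkSpace ⊔ ψ.linkSpace
  | and φ ψ => φ.linkSpace ⊔ ψ.linkSpace
  | ex x φ => φ.linkSpace ⊓ LinearMap.ker (Finsupp.lapply x)
  | all x φ => φ.linkSpace ⊓ LinearMap.ker (Finsupp.lapply x)

theorem rank_linkSpace_le (φ : FOFormula τ) : Module.rank ℚ φ.linkSpace ≤ φ.eqCount := by
  induction φ with
  | eq x y =>
    simp only [linkSpace, eqCount]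
    exact (rank_span_le _).trans (by simp)
  | neq x y =>
    simp only [linkSpace, eqCount]
    exact (rank_span_le _).trans (by simp)
  | pred P x => exact (rank_bot ℚ _).le.trans zero_le
  | npred P x => exact (rank_bot ℚ _).le.trans zero_le
  | or φ ψ hφ hψ =>
    simp only [linkSpace, eqCount, Nat.cast_add]
    exact (Submodule.rank_add_le_rank_add_rank _ _).trans (add_le_add hφ hψ)
  | and φ ψ hφ hψ =>
    simp only [linkSpace, eqCount, Nat.cast_add]
    exact (Submodule.rank_add_le_rank_add_rank _ _).trans (add_le_add hφ hψ)
  | ex x φ hφ => exact (Submodule.rank_mono inf_le_left).trans hφ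
  | all x φ hφ => exact (Submodule.rank_mono inf_le_left).trans hφ

end FOFormula

/-- Two variables are linked by a space of vectors if it contains the difference of their
basis vectors. -/
def Linked (V : Submodule ℚ (ℕ →₀ ℚ)) (x y : ℕ) : Prop :=
  Finsupp.single x (1 : ℚ) - Finsupp.single y 1 ∈ V

theorem Linked.equivalence (V : Submodule ℚ (ℕ →₀ ℚ)) : Equivalence (Linked V) where
  refl x := by simp [Linked]
  symm {x y} h := by
    have := V.neg_mem h
    rwa [neg_sub] at this
  trans {x y z} h h' := by
    have := V.add_mem h h'
    rwa [sub_add_sub_cancel] at this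

theorem Linked.mono {V W : Submodule ℚ (ℕ →₀ ℚ)} (h : V ≤ W) {x y : ℕ} (hxy : Linked V x y) :
    Linked W x y := h hxy

theorem Linked.inf_ker {V : Submodule ℚ (ℕ →₀ ℚ)} {x y z : ℕ} (h : Linked V x y)
    (hx : x ≠ z) (hy : y ≠ z) : Linked (V ⊓ LinearMap.ker (Finsupp.lapply z)) x y :=
  ⟨h, by simp [hx, hy]⟩

theorem card_le_of_linked {V : Submodule ℚ (ℕ →₀ ℚ)} {r : ℕ} (hV : Module.rank ℚ V ≤ r)
    {y : ℕ} {S : Finset ℕ} (hy : y ∉ S) (hS : ∀ x ∈ S, Linked V y x) : S.card ≤ r := by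
  let v : S → V := fun x => ⟨_, (Linked.equivalence V).symm (hS x x.2)⟩
  let p : (ℕ →₀ ℚ) →ₗ[ℚ] (ℕ →₀ ℚ) :=
    LinearMap.id - (Finsupp.lapply y).smulRight (Finsupp.single y 1)
  have hv : LinearIndependent ℚ v := by
    apply LinearIndependent.of_comp (p ∘ₗ V.subtype)
    have : (p ∘ₗ V.subtype) ∘ v = fun x : S => Finsupp.single (x : ℕ) (1 : ℚ) := by
      funext x
      have hxy : (x : ℕ) ≠ y := fun h => hy (h ▸ x.2)
      simp [p, v, hxy]
    rw [this]
    exact (Finsupp.linearIndependent_single_one ℚ ℕ).comp _ Subtype.val_injective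
  have := hv.cardinal_le_rank.trans hV
  simpa using this

namespace UnaryModel

variable {τ : Type*} [Fintype τ] [DecidableEq τ] {n : ℕ}

/-- The set of predicates that hold of `a`. -/
def typeOf (M : UnaryModel τ n) (a : Fin n) : Finset τ := {P | a ∈ M P}

/-- The number of elements of type `t`. -/
def count (M : UnaryModel τ n) (t : Finset τ) : ℕ :=
  (Finset.univ.filter fun a => M.typeOf a = t).card

theorem mem_typeOf {M : UnaryModel τ n} {a : Fin n} {P : τ} : P ∈ M.typeOf a ↔ a ∈ M P := by
  simp [typeOf]

theorem sum_count (M : UnaryModel τ n) : ∑ t, M.count t = n := by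
  have := Finset.card_eq_sum_card_fiberwise (f := M.typeOf) (s := Finset.univ)
    (t := Finset.univ) (fun _ _ => Finset.mem_coe.2 (Finset.mem_univ _))
  simpa [count] using this.symm

theorem iso_iff_typeOf {M N : UnaryModel τ n} :
    M.Iso N ↔ ∃ e : Fin n ≃ Fin n, ∀ a, M.typeOf a = N.typeOf (e a) := by
  refine exists_congr fun e => ⟨fun h a => ?_, fun h P a => ?_⟩
  · ext P
    rw [mem_typeOf, mem_typeOf, h]
  · rw [← mem_typeOf, ← mem_typeOf, h]

theorem iso_iff_count {M N : UnaryModel τ n} : M.Iso N ↔ ∀ t, M.count t = N.count t := by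
  rw [iso_iff_typeOf]
  constructor
  · rintro ⟨e, he⟩ t
    refine Finset.card_bij (fun a _ => e a) (fun a ha => ?_) (fun a _ b _ h => e.injective h)
      (fun b hb => ⟨e.symm b, ?_, e.apply_symm_apply b⟩)
    · simpa [← he a] using ha
    · simpa [he] using hb
  · intro h
    have key : ∀ t, Nonempty ({a // M.typeOf a = t} ≃ {a // N.typeOf a = t}) := fun t =>
      Fintype.card_eq.1 (by simpa only [count, Fintype.card_subtype] using h t)
    let e := fun t => (key t).some
    refine ⟨(Equiv.sigmaFiberEquiv M.typeOf).symm.trans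
      ((Equiv.sigmaCongrRight e).trans (Equiv.sigmaFiberEquiv N.typeOf)), fun a => ?_⟩
    exact (e (M.typeOf a) ⟨a, rfl⟩).2.symm

/-- On the variables in `F` the two interpretations are defined, assign elements of the same type,
and agree on the equalities between variables related by `R`. -/
structure LocalIso (M N : UnaryModel τ n) (s s' : ℕ → Option (Fin n)) (F : Finset ℕ)
    (R : ℕ → ℕ → Prop) : Prop where
  type_eq : ∀ x ∈ F, ∃ a b, s x = some a ∧ s' x = some b ∧ M.typeOf a = N.typeOf b
  eq_iff : ∀ x ∈ F, ∀ y ∈ F, R x y → (s x = s y ↔ s' x = s' y)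

/-- For each type the two models have equally many elements, or at least `m` each. -/
def CountEquiv (m : ℕ) (M N : UnaryModel τ n) : Prop :=
  ∀ t, M.count t = N.count t ∨ m ≤ M.count t ∧ m ≤ N.count t

theorem CountEquiv.symm {m : ℕ} {M N : UnaryModel τ n} (h : CountEquiv m M N) :
    CountEquiv m N M := fun t => (h t).imp Eq.symm And.symm

namespace LocalIso

variable {M N : UnaryModel τ n} {s s' : ℕ → Option (Fin n)} {F : Finset ℕ} {R : ℕ → ℕ → Prop}

theorem symm (h : LocalIso M N s s' F R) : LocalIso N M s' s F R where
  type_eq x hx := by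
    obtain ⟨a, b, ha, hb, hab⟩ := h.type_eq x hx
    exact ⟨b, a, hb, ha, hab.symm⟩
  eq_iff x hx y hy hxy := (h.eq_iff x hx y hy hxy).symm

theorem mono (h : LocalIso M N s s' F R) {G : Finset ℕ} {Q : ℕ → ℕ → Prop} (hG : G ⊆ F)
    (hQ : ∀ x ∈ G, ∀ y ∈ G, Q x y → R x y) : LocalIso M N s s' G Q where
  type_eq x hx := h.type_eq x (hG hx)
  eq_iff x hx y hy hxy := h.eq_iff x (hG hx) y (hG hy) (hQ x hx y hy hxy)

theorem exists_match {m : ℕ} (hc : CountEquiv m M N)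
    (h : LocalIso M N s s' F fun _ _ => True) (hF : F.card < m) (a : Fin n) :
    ∃ b, M.typeOf a = N.typeOf b ∧ ∀ x ∈ F, s x = some a ↔ s' x = some b := by
  by_cases hx : ∃ x ∈ F, s x = some a
  · obtain ⟨x, hxF, hxa⟩ := hx
    obtain ⟨a', b, ha', hb, hab⟩ := h.type_eq x hxF
    obtain rfl : a' = a := by simpa [ha'] using hxa
    refine ⟨b, hab, fun y hy => ?_⟩
    rw [← hxa, ← hb]
    exact h.eq_iff y hy x hxF trivial
  · push Not at hx
    classical
    let G : Finset ℕ := {x ∈ F | ∃ a', s x = some a' ∧ M.typeOf a' = M.typeOf a}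
    have hGF : G ⊆ F := Finset.filter_subset _ _
    have hle : (G.image s').card ≤ (G.image s).card := by
      let g : Option (Fin n) → Option (Fin n) := fun o =>
        if h : ∃ x ∈ G, s x = o then s' h.choose else none
      have hg : G.image s' = (G.image s).image g := by
        rw [Finset.image_image]
        refine Finset.image_congr fun x hxG => ?_
        have hex : ∃ x' ∈ G, s x' = s x := ⟨x, hxG, rfl⟩
        have : g (s x) = s' hex.choose := dif_pos hex
        rw [Function.comp_apply, this]
        exact ((h.eq_iff _ (hGF hex.choose_spec.1) _ (hGF hxG) trivial).1
          hex.choose_spec.2).symm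
      rw [hg]
      exact Finset.card_image_le
    have hlt : (G.image s).card < M.count (M.typeOf a) := by
      rw [count, ← Finset.card_map (s := Finset.univ.filter _) Function.Embedding.some]
      refine Finset.card_lt_card ⟨fun o ho => ?_, fun hsub => ?_⟩
      · obtain ⟨x, hxG, rfl⟩ := Finset.mem_image.1 ho
        obtain ⟨a', ha', ht⟩ := (Finset.mem_filter.1 hxG).2
        simp [ha', ht]
      · obtain ⟨x, hxG, hxa⟩ := Finset.mem_image.1 (hsub (x := some a) (by simp))
        exact hx x (hGF hxG) hxa
    have hltN : (G.image s').card < N.count (M.typeOf a) := by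
      rcases hc (M.typeOf a) with heq | ⟨-, hm⟩
      · omega
      · have := Finset.card_le_card hGF
        have := Finset.card_image_le (s := G) (f := s')
        omega
    rw [count, ← Finset.card_map (s := Finset.univ.filter _) Function.Embedding.some] at hltN
    obtain ⟨o, ho, hoG⟩ := Finset.exists_mem_notMem_of_card_lt_card hltN
    obtain ⟨b, hb, rfl⟩ := Finset.mem_map.1 ho
    have hbt : N.typeOf b = M.typeOf a := by simpa using hb
    refine ⟨b, hbt.symm, fun x hxF => ⟨fun hxa => (hx x hxF hxa).elim, fun hxb => ?_⟩⟩
    refine (hoG (Finset.mem_image.2 ⟨x, Finset.mem_filter.2 ⟨hxF, ?_⟩, hxb⟩)).elim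
    obtain ⟨a', b', ha', hb', hab⟩ := h.type_eq x hxF
    obtain rfl : b' = b := by simpa [hb'] using hxb
    exact ⟨a', ha', hab.trans hbt⟩

theorem extend {m : ℕ} (hc : CountEquiv m M N) (hR : Equivalence R) {y : ℕ}
    (h : LocalIso M N s s' (F.erase y) R)
    (hF : ∀ S ⊆ F.erase y, (∀ x ∈ S, R y x) → S.card < m) (a : Fin n) :
    ∃ b, LocalIso M N (Function.update s y (some a)) (Function.update s' y (some b))
      (insert y F) R := by
  classical
  let S := (F.erase y).filter (R y)
  have hS : LocalIso M N s s' S fun _ _ => True :=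
    h.mono (Finset.filter_subset _ _) fun x hx z hz _ =>
      hR.trans (hR.symm (Finset.mem_filter.1 hx).2) (Finset.mem_filter.1 hz).2
  obtain ⟨b, hab, hb⟩ := exists_match hc hS
    (hF S (Finset.filter_subset _ _) fun x hx => (Finset.mem_filter.1 hx).2) a
  have hmem : ∀ x ∈ insert y F, x ≠ y → x ∈ F.erase y := fun x hx hxy =>
    Finset.mem_erase.2 ⟨hxy, (Finset.mem_insert.1 hx).resolve_left hxy⟩
  refine ⟨b, ⟨fun x hx => ?_, fun x hx z hz hxz => ?_⟩⟩
  · by_cases hxy : x = y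
    · subst hxy
      exact ⟨a, b, by simp, by simp, hab⟩
    · simpa [hxy] using h.type_eq x (hmem x hx hxy)
  · by_cases hxy : x = y <;> by_cases hzy : z = y
    · simp [hxy, hzy]
    · subst hxy
      have := hb z (Finset.mem_filter.2 ⟨hmem z hz hzy, hxz⟩)
      simpa [hzy, eq_comm] using this
    · subst hzy
      have := hb x (Finset.mem_filter.2 ⟨hmem x hx hxy, hR.symm hxz⟩)
      simpa [hxy] using this
    · simpa [hxy, hzy] using h.eq_iff x (hmem x hx hxy) z (hmem z hz hzy) hxz

theorem sat_eq {x y : ℕ} (h : LocalIso M N s s' {x, y} R) (hxy : R x y)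
    (hs : M.Sat s (.eq x y)) : N.Sat s' (.eq x y) := by
  obtain ⟨a, _, ha, hb, rfl⟩ := hs
  obtain ⟨-, b, -, hb', -⟩ := h.type_eq x (by simp)
  exact ⟨b, b, hb', ((h.eq_iff x (by simp) y (by simp) hxy).1 (ha.trans hb.symm)) ▸ hb', rfl⟩

theorem sat_neq {x y : ℕ} (h : LocalIso M N s s' {x, y} R) (hxy : R x y)
    (hs : M.Sat s (.neq x y)) : N.Sat s' (.neq x y) := by
  obtain ⟨a, b, ha, hb, hab⟩ := hs
  obtain ⟨-, a', -, ha', -⟩ := h.type_eq x (by simp)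
  obtain ⟨-, b', -, hb', -⟩ := h.type_eq y (by simp)
  refine ⟨a', b', ha', hb', fun hab' => hab ?_⟩
  have := (h.eq_iff x (by simp) y (by simp) hxy).2 (by rw [ha', hb', hab'])
  simpa [ha, hb] using this

theorem sat_pred {P : τ} {x : ℕ} (h : LocalIso M N s s' {x} R)
    (hs : M.Sat s (.pred P x)) : N.Sat s' (.pred P x) := by
  obtain ⟨a, ha, haP⟩ := hs
  obtain ⟨a', b, ha', hb, hab⟩ := h.type_eq x (by simp)
  obtain rfl : a' = a := by simpa [ha'] using ha
  exact ⟨b, hb, mem_typeOf.1 (hab ▸ mem_typeOf.2 haP)⟩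

theorem sat_npred {P : τ} {x : ℕ} (h : LocalIso M N s s' {x} R)
    (hs : M.Sat s (.npred P x)) : N.Sat s' (.npred P x) := by
  obtain ⟨a, ha, haP⟩ := hs
  obtain ⟨a', b, ha', hb, hab⟩ := h.type_eq x (by simp)
  obtain rfl : a' = a := by simpa [ha'] using ha
  exact ⟨b, hb, fun hbP => haP (mem_typeOf.1 (hab ▸ mem_typeOf.2 hbP))⟩

/-- Formulas with fewer than `m` equality literals cannot count beyond `m`. -/
theorem sat_of_eqCount_lt {m : ℕ} (hc : CountEquiv m M N) (φ : FOFormula τ)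
    (hφ : φ.eqCount < m) (h : LocalIso M N s s' φ.freeVars (Linked φ.linkSpace))
    (hs : M.Sat s φ) : N.Sat s' φ := by
  have hcard : ∀ (ψ : FOFormula τ) (y : ℕ), ψ.eqCount < m → ∀ S ⊆ ψ.freeVars.erase y,
      (∀ x ∈ S, Linked ψ.linkSpace y x) → S.card < m := fun ψ y hψ S hS hl =>
    (card_le_of_linked ψ.rank_linkSpace_le (fun hy => by simpa using hS hy) hl).trans_lt hψ
  have herase : ∀ (ψ : FOFormula τ) (y : ℕ) (s s' : ℕ → Option (Fin n)),
      LocalIso M N s s' (ψ.freeVars.erase y)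
        (Linked (ψ.linkSpace ⊓ LinearMap.ker (Finsupp.lapply y))) →
      LocalIso M N s s' (ψ.freeVars.erase y) (Linked ψ.linkSpace) := fun ψ y s s' h =>
    h.mono subset_rfl fun x hx z hz hxz =>
      hxz.inf_ker (Finset.ne_of_mem_erase hx) (Finset.ne_of_mem_erase hz)
  induction φ generalizing s s' with
  | eq x y => exact sat_eq h (Submodule.subset_span rfl) hs
  | neq x y => exact sat_neq h (Submodule.subset_span rfl) hs
  | pred P x => exact sat_pred h hs
  | npred P x => exact sat_npred h hs
  | or φ ψ ihφ ihψ =>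
    simp only [FOFormula.eqCount] at hφ
    refine hs.imp (ihφ (by omega) (h.mono Finset.subset_union_left fun x _ y _ hxy => ?_))
      (ihψ (by omega) (h.mono Finset.subset_union_right fun x _ y _ hxy => ?_))
    · exact hxy.mono le_sup_left
    · exact hxy.mono le_sup_right
  | and φ ψ ihφ ihψ =>
    simp only [FOFormula.eqCount] at hφ
    refine hs.imp (ihφ (by omega) (h.mono Finset.subset_union_left fun x _ y _ hxy => ?_))
      (ihψ (by omega) (h.mono Finset.subset_union_right fun x _ y _ hxy => ?_))
    · exact hxy.mono le_sup_left
    · exact hxy.mono le_sup_right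
  | ex y ψ ih =>
    obtain ⟨a, ha⟩ := hs
    obtain ⟨b, hb⟩ := extend hc (Linked.equivalence _) (herase ψ y s s' h) (hcard ψ y hφ) a
    exact ⟨b, ih hφ (hb.mono (Finset.subset_insert _ _) fun _ _ _ _ h => h) ha⟩
  | all y ψ ih =>
    intro b
    obtain ⟨a, ha⟩ := extend hc.symm (Linked.equivalence _) (herase ψ y s s' h).symm
      (hcard ψ y hφ) b
    exact ih hφ (ha.symm.mono (Finset.subset_insert _ _) fun _ _ _ _ h => h) (hs a)

/-- Formulas with at most `m` quantifiers cannot count beyond `m`. -/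
theorem sat_of_quantCount_le {m : ℕ} (hc : CountEquiv m M N) (φ : FOFormula τ)
    (hF : φ.freeVars ⊆ F) (hφ : F.card + φ.quantCount ≤ m)
    (h : LocalIso M N s s' F fun _ _ => True) (hs : M.Sat s φ) : N.Sat s' φ := by
  have hR : Equivalence fun _ _ : ℕ => True := ⟨fun _ => trivial, fun _ => trivial,
    fun _ _ => trivial⟩
  induction φ generalizing s s' F with
  | eq x y => exact sat_eq (h.mono hF fun _ _ _ _ h => h) trivial hs
  | neq x y => exact sat_neq (h.mono hF fun _ _ _ _ h => h) trivial hs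
  | pred P x => exact sat_pred (h.mono hF fun _ _ _ _ h => h) hs
  | npred P x => exact sat_npred (h.mono hF fun _ _ _ _ h => h) hs
  | or φ ψ ihφ ihψ =>
    simp only [FOFormula.quantCount] at hφ
    exact hs.imp (ihφ (Finset.subset_union_left.trans hF) (by omega) h)
      (ihψ (Finset.subset_union_right.trans hF) (by omega) h)
  | and φ ψ ihφ ihψ =>
    simp only [FOFormula.quantCount] at hφ
    exact hs.imp (ihφ (Finset.subset_union_left.trans hF) (by omega) h)
      (ihψ (Finset.subset_union_right.trans hF) (by omega) h)
  | ex y ψ ih =>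
    simp only [FOFormula.quantCount] at hφ
    have hsub : ψ.freeVars ⊆ insert y F := Finset.subset_insert_iff.2 hF
    have hins := Finset.card_insert_le y F
    have herase := h.mono (Finset.erase_subset y F) fun _ _ _ _ h => h
    have hcard : ∀ S ⊆ F.erase y, (∀ x ∈ S, True) → S.card < m := fun S hS _ => by
      have := Finset.card_le_card (hS.trans (Finset.erase_subset y F))
      omega
    obtain ⟨a, ha⟩ := hs
    obtain ⟨b, hb⟩ := extend hc hR herase hcard a
    exact ⟨b, ih hsub (by omega) hb ha⟩
  | all y ψ ih =>
    simp only [FOFormula.quantCount] at hφ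
    have hsub : ψ.freeVars ⊆ insert y F := Finset.subset_insert_iff.2 hF
    have hins := Finset.card_insert_le y F
    have herase := h.mono (Finset.erase_subset y F) fun _ _ _ _ h => h
    have hcard : ∀ S ⊆ F.erase y, (∀ x ∈ S, True) → S.card < m := fun S hS _ => by
      have := Finset.card_le_card (hS.trans (Finset.erase_subset y F))
      omega
    intro b
    obtain ⟨a, ha⟩ := extend hc.symm hR herase.symm hcard b
    exact ih hsub (by omega) ha.symm (hs a)

end LocalIso

theorem CountEquiv.three_mul_le_size {m : ℕ} {M N : UnaryModel τ n} (hc : CountEquiv m M N)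
    {φ : FOFormula τ} (hφ : φ.IsSentence) (hM : M.Models φ) (hN : ¬ N.Models φ) :
    3 * m ≤ φ.size := by
  have hiso : ∀ R, LocalIso M N (fun _ => none) (fun _ => none) φ.freeVars R := fun R => by
    rw [hφ]
    exact ⟨by simp, by simp⟩
  have h₁ : m ≤ φ.eqCount := by
    by_contra! h
    exact hN (LocalIso.sat_of_eqCount_lt hc φ h (hiso _) hM)
  have h₂ : m < φ.quantCount := by
    by_contra! h
    refine hN (LocalIso.sat_of_quantCount_le hc φ subset_rfl ?_ (hiso _) hM)
    rw [hφ]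
    simpa using h
  have := φ.two_mul_eqCount_add_quantCount_le
  omega

/-- Changing the type of one element. -/
theorem exists_countEquiv_not_iso [Nonempty τ] {M : UnaryModel τ n} {m : ℕ}
    (hm : ∀ t, m + 1 ≤ M.count t) : ∃ N : UnaryModel τ n, CountEquiv m M N ∧ ¬ N.Iso M := by
  obtain ⟨t, u, htu⟩ := exists_pair_ne (Finset τ)
  obtain ⟨a, ha⟩ : ∃ a, M.typeOf a = t := by
    have : 0 < M.count t := by have := hm t; omega
    obtain ⟨a, ha⟩ := Finset.card_pos.1 this
    exact ⟨a, by simpa using ha⟩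
  let f := Function.update M.typeOf a u
  let N : UnaryModel τ n := fun P => {b | P ∈ f b}
  have hf : N.typeOf = f := by
    funext b
    ext P
    simp [N, mem_typeOf]
  have hne : ∀ v, (Finset.univ.filter fun b => M.typeOf b = v).erase a
      ⊆ Finset.univ.filter fun b => N.typeOf b = v := fun v b hb => by
    have hb' := Finset.mem_erase.1 hb
    simpa [hf, f, hb'.1] using hb'.2
  refine ⟨N, fun v => Or.inr ⟨by have := hm v; omega, ?_⟩, fun hN => ?_⟩
  · have h₁ := hm v
    have h₂ := Finset.pred_card_le_card_erase (a := a)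
      (s := Finset.univ.filter fun b => M.typeOf b = v)
    have h₃ := Finset.card_le_card (hne v)
    unfold count at *
    omega
  · have hlt : N.count t < M.count t := by
      refine Finset.card_lt_card ⟨fun b hb => ?_, fun hsub => ?_⟩
      · have hba : b ≠ a := by
          rintro rfl
          simp [hf, f, htu.symm] at hb
        simpa [hf, f, hba] using hb
      · have := hsub (x := a) (by simpa using ha)
        simp [hf, f, htu.symm] at this
    exact hlt.ne (iso_iff_count.1 hN t)

theorem DefinedBy.three_mul_le_size [Nonempty τ] {M : UnaryModel τ n} {m : ℕ}
    (hm : ∀ t, m + 1 ≤ M.count t) {φ : FOFormula τ} (hφ : M.DefinedBy φ) :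
    3 * m ≤ φ.size := by
  obtain ⟨N, hc, hN⟩ := exists_countEquiv_not_iso hm
  exact hc.three_mul_le_size hφ.1 ((hφ.2 M).2 (iso_iff_count.2 fun _ => rfl))
    fun h => hN ((hφ.2 N).1 h)

end UnaryModel

namespace FOFormula

variable {τ : Type*}

/-- A conjunction of a list of formulas. -/
def bigAnd : List (FOFormula τ) → FOFormula τ
  | [] => all 0 (eq 0 0)
  | φ :: l => and φ (bigAnd l)

/-- A disjunction of a list of formulas. -/
def bigOr : List (FOFormula τ) → FOFormula τ
  | [] => ex 0 (neq 0 0)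
  | φ :: l => or φ (bigOr l)

/-- Universal quantification over the variables `x₀, …, x_{m-1}`. -/
def allBlock : ℕ → FOFormula τ → FOFormula τ
  | 0, φ => φ
  | m + 1, φ => allBlock m (all m φ)

theorem size_bigAnd (l : List (FOFormula τ)) :
    (bigAnd l).size = 2 + (l.map fun φ => φ.size + 1).sum := by
  induction l with
  | nil => rfl
  | cons φ l ih => simp only [bigAnd, size, ih, List.map_cons, List.sum_cons]; omega

theorem size_bigOr (l : List (FOFormula τ)) :
    (bigOr l).size = 2 + (l.map fun φ => φ.size + 1).sum := by
  induction l with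
  | nil => rfl
  | cons φ l ih => simp only [bigOr, size, ih, List.map_cons, List.sum_cons]; omega

theorem size_allBlock (m : ℕ) (φ : FOFormula τ) : (allBlock m φ).size = m + φ.size := by
  induction m generalizing φ with
  | zero => simp [allBlock]
  | succ m ih => simp only [allBlock, ih, size]; omega

theorem freeVars_bigAnd_subset {l : List (FOFormula τ)} {F : Finset ℕ}
    (h : ∀ φ ∈ l, φ.freeVars ⊆ F) : (bigAnd l).freeVars ⊆ F := by
  induction l with
  | nil => simp [bigAnd, freeVars]
  | cons φ l ih =>
    exact Finset.union_subset (h φ (by simp)) (ih fun ψ hψ => h ψ (by simp [hψ]))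

theorem freeVars_bigOr_subset {l : List (FOFormula τ)} {F : Finset ℕ}
    (h : ∀ φ ∈ l, φ.freeVars ⊆ F) : (bigOr l).freeVars ⊆ F := by
  induction l with
  | nil => simp [bigOr, freeVars]
  | cons φ l ih =>
    exact Finset.union_subset (h φ (by simp)) (ih fun ψ hψ => h ψ (by simp [hψ]))

theorem freeVars_allBlock (m : ℕ) (φ : FOFormula τ) :
    (allBlock m φ).freeVars = φ.freeVars \ Finset.range m := by
  induction m generalizing φ with
  | zero => simp [allBlock]
  | succ m ih =>
    rw [allBlock, ih, freeVars, Finset.range_add_one]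
    ext x
    simp only [Finset.mem_sdiff, Finset.mem_erase, Finset.mem_insert]
    tauto

/-- The statement that the variable `y` differs from `x_i` for `a ≤ i < a + d`. -/
def neqRange (y a d : ℕ) : FOFormula τ :=
  bigAnd ((List.range d).map fun i => neq y (a + i))

theorem size_neqRange (y a d : ℕ) : (neqRange y a d : FOFormula τ).size = 2 + 2 * d := by
  simp [neqRange, size_bigAnd, size, Function.comp_def, mul_comm]

theorem freeVars_neqRange_subset {y a d : ℕ} {F : Finset ℕ} (hy : y ∈ F)
    (h : ∀ i < a + d, i ∈ F) : (neqRange y a d : FOFormula τ).freeVars ⊆ F := by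
  refine freeVars_bigAnd_subset fun φ hφ => ?_
  obtain ⟨i, hi, rfl⟩ := List.mem_map.1 hφ
  have := List.mem_range.1 hi
  simpa [freeVars, Finset.insert_subset_iff, hy] using h (a + i) (by omega)

variable [Fintype τ] [DecidableEq τ]

/-- The statement that the variable `x` has type `t`. -/
noncomputable def hasType (t : Finset τ) (x : ℕ) : FOFormula τ :=
  bigAnd (Finset.univ.toList.map fun P => if P ∈ t then pred P x else npred P x)

theorem size_hasType (t : Finset τ) (x : ℕ) :
    (hasType t x).size = 2 + 2 * Fintype.card τ := by
  have : ∀ P, (if P ∈ t then pred P x else npred P x : FOFormula τ).size = 1 := fun P => by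
    split_ifs <;> rfl
  simp [hasType, size_bigAnd, Function.comp_def, this, mul_comm]

theorem freeVars_hasType_subset (t : Finset τ) (x : ℕ) : (hasType t x).freeVars ⊆ {x} := by
  refine freeVars_bigAnd_subset fun φ hφ => ?_
  obtain ⟨P, -, rfl⟩ := List.mem_map.1 hφ
  split_ifs <;> simp [freeVars]

/-- For each type `t` in the set `A` there is an element of type `t`. -/
noncomputable def realizes (A : Finset (Finset τ)) : FOFormula τ :=
  bigAnd (A.toList.map fun t => ex 0 (hasType t 0))

/-- For all `x₀, …, x_{m-1}` and each element `x_m` of type `t` there is an element of type `t`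
other than the first `m₀ + d t` of the `x_i`. -/
noncomputable def avoids (m m₀ : ℕ) (d : Finset τ → ℕ) : FOFormula τ :=
  allBlock m <| all m <| ex (m + 1) <| and (neqRange (m + 1) 0 m₀) <|
    bigOr (Finset.univ.toList.map fun t =>
      and (hasType t m) (and (hasType t (m + 1)) (neqRange (m + 1) m₀ (d t))))

theorem size_realizes_le (A : Finset (Finset τ)) :
    (realizes A).size ≤ 2 + 2 ^ Fintype.card τ * (4 + 2 * Fintype.card τ) := by
  have h : A.card ≤ 2 ^ Fintype.card τ := by simpa using Finset.card_le_univ A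
  have : (realizes A).size = 2 + A.card * (4 + 2 * Fintype.card τ) := by
    simp only [realizes, size_bigAnd, List.map_map, Function.comp_def, size, size_hasType,
      List.map_const', List.sum_replicate, Finset.length_toList, smul_eq_mul]
    ring
  rw [this]
  gcongr

theorem size_avoids (m m₀ : ℕ) (d : Finset τ → ℕ) :
    (avoids m m₀ d).size =
      m + 2 * m₀ + 7 + ∑ t, (9 + 4 * Fintype.card τ + 2 * d t) := by
  simp only [avoids, size_allBlock, size, size_neqRange, size_bigOr, size_hasType, List.map_map,
    Function.comp_def, Finset.sum_map_toList]
  have : ∀ t, 2 + 2 * Fintype.card τ + (2 + 2 * Fintype.card τ + (2 + 2 * d t) + 1) + 1 + 1 =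
      9 + 4 * Fintype.card τ + 2 * d t := fun t => by omega
  simp only [this]
  omega

theorem isSentence_realizes (A : Finset (Finset τ)) : (realizes A).IsSentence := by
  refine Finset.subset_empty.1 (freeVars_bigAnd_subset fun φ hφ => ?_)
  obtain ⟨t, -, rfl⟩ := List.mem_map.1 hφ
  intro x hx
  obtain ⟨hx0, hx⟩ := Finset.mem_erase.1 hx
  exact (hx0 (by simpa using freeVars_hasType_subset t 0 hx)).elim

theorem isSentence_avoids {m m₀ : ℕ} {d : Finset τ → ℕ} (hm₀ : m₀ ≤ m)
    (hd : ∀ t, m₀ + d t ≤ m) : (avoids m m₀ d).IsSentence := by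
  have hsub : ((neqRange (m + 1) 0 m₀).and <| bigOr (Finset.univ.toList.map fun t : Finset τ =>
      and (hasType t m) (and (hasType t (m + 1)) (neqRange (m + 1) m₀ (d t))))).freeVars ⊆
        Finset.range (m + 2) := by
    refine Finset.union_subset (freeVars_neqRange_subset (by simp) fun i hi => ?_)
      (freeVars_bigOr_subset fun φ hφ => ?_)
    · rw [Finset.mem_range]; omega
    · obtain ⟨t, -, rfl⟩ := List.mem_map.1 hφ
      refine Finset.union_subset ((freeVars_hasType_subset _ _).trans (by simp))
        (Finset.union_subset ((freeVars_hasType_subset _ _).trans (by simp))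
          (freeVars_neqRange_subset (by simp) fun i hi => ?_))
      have := hd t
      rw [Finset.mem_range]; omega
  rw [IsSentence, avoids, freeVars_allBlock, freeVars, freeVars, Finset.sdiff_eq_empty_iff_subset]
  intro x hx
  simp only [Finset.mem_erase] at hx
  have := Finset.mem_range.1 (hsub hx.2.2)
  rw [Finset.mem_range]; omega

end FOFormula

namespace UnaryModel

open FOFormula

variable {τ : Type*} {n : ℕ}

theorem sat_bigAnd {M : UnaryModel τ n} {s : ℕ → Option (Fin n)} {l : List (FOFormula τ)} :
    M.Sat s (bigAnd l) ↔ ∀ φ ∈ l, M.Sat s φ := by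
  induction l with
  | nil => simp [bigAnd, Sat]
  | cons φ l ih => simp [bigAnd, Sat, ih]

theorem sat_bigOr {M : UnaryModel τ n} {s : ℕ → Option (Fin n)} {l : List (FOFormula τ)} :
    M.Sat s (bigOr l) ↔ ∃ φ ∈ l, M.Sat s φ := by
  induction l with
  | nil => simp [bigOr, Sat]
  | cons φ l ih => simp [bigOr, Sat, ih]

theorem sat_allBlock [NeZero n] {M : UnaryModel τ n} {m : ℕ} {s : ℕ → Option (Fin n)}
    {φ : FOFormula τ} :
    M.Sat s (allBlock m φ) ↔
      ∀ f : ℕ → Fin n, M.Sat (fun x => if x < m then some (f x) else s x) φ := by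
  induction m generalizing φ with
  | zero => simp [allBlock]
  | succ m ih =>
    rw [allBlock, ih]
    constructor
    · intro h f
      convert h f (f m) using 1
      funext x
      rcases lt_trichotomy x m with hx | rfl | hx
      · simp [hx, hx.ne, hx.trans (Nat.lt_succ_self m)]
      · simp
      · have h₁ : ¬ x < m := by omega
        have h₂ : ¬ x < m + 1 := by omega
        simp [h₁, h₂, hx.ne']
    · intro h f a
      convert h (Function.update f m a) using 1
      funext x
      rcases lt_trichotomy x m with hx | rfl | hx
      · simp [hx, hx.ne, hx.trans (Nat.lt_succ_self m)]
      · simp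
      · have h₁ : ¬ x < m := by omega
        have h₂ : ¬ x < m + 1 := by omega
        simp [h₁, h₂, hx.ne']

theorem sat_neqRange {M : UnaryModel τ n} {s : ℕ → Option (Fin n)} {y a d : ℕ} {b : Fin n}
    {f : ℕ → Fin n} (hy : s y = some b) (hf : ∀ i < a + d, s i = some (f i)) :
    M.Sat s (neqRange y a d) ↔ ∀ i, a ≤ i → i < a + d → b ≠ f i := by
  simp only [neqRange, sat_bigAnd, List.forall_mem_map, List.mem_range]
  constructor
  · intro h i hai hi
    obtain ⟨j, rfl⟩ := Nat.exists_eq_add_of_le hai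
    obtain ⟨b', c, hb', hc, hne⟩ := h j (by omega)
    rw [hy, Option.some_inj] at hb'
    rw [hf _ hi, Option.some_inj] at hc
    rwa [hb', hc]
  · intro h i hi
    exact ⟨b, f (a + i), hy, hf _ (by omega), h _ (by omega) (by omega)⟩

variable [Fintype τ] [DecidableEq τ]

theorem sat_hasType {M : UnaryModel τ n} {s : ℕ → Option (Fin n)} {x : ℕ} {a : Fin n}
    (hx : s x = some a) {t : Finset τ} : M.Sat s (hasType t x) ↔ M.typeOf a = t := by
  simp only [hasType, sat_bigAnd, List.forall_mem_map, Finset.mem_toList, Finset.mem_univ,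
    true_implies, Finset.ext_iff, mem_typeOf]
  refine forall_congr' fun P => ?_
  by_cases hP : P ∈ t <;> simp [hP, Sat, hx]

theorem models_realizes {M : UnaryModel τ n} {A : Finset (Finset τ)} :
    M.Models (realizes A) ↔ ∀ t ∈ A, ∃ a, M.typeOf a = t := by
  simp only [realizes, Models, sat_bigAnd, List.forall_mem_map, Finset.mem_toList, Sat]
  refine forall₂_congr fun t _ => exists_congr fun a => sat_hasType (by simp)

theorem models_avoids [NeZero n] {M : UnaryModel τ n} {m m₀ : ℕ} {d : Finset τ → ℕ}
    (hm₀ : m₀ ≤ m) (hd : ∀ t, m₀ + d t ≤ m) :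
    M.Models (avoids m m₀ d) ↔ ∀ (f : ℕ → Fin n) (c : Fin n), ∃ b, M.typeOf b = M.typeOf c ∧
      ∀ i < m₀ + d (M.typeOf c), b ≠ f i := by
  rw [Models, avoids, sat_allBlock]
  refine forall_congr' fun f => ?_
  simp only [Sat]
  refine forall_congr' fun c => exists_congr fun b => ?_
  set s : ℕ → Option (Fin n) := Function.update
    (Function.update (fun x => if x < m then some (f x) else none) m (some c)) (m + 1) (some b)
    with hs
  have hsb : s (m + 1) = some b := by simp [hs]
  have hsc : s m = some c := by simp [hs]
  have hsf : ∀ i < m, s i = some (f i) := fun i hi => by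
    have h₁ : i ≠ m + 1 := by omega
    simp [hs, h₁, hi.ne, hi]
  rw [sat_neqRange hsb fun i hi => hsf i (by omega)]
  simp only [sat_bigOr, List.mem_map, exists_exists_eq_and, Finset.mem_toList, Finset.mem_univ, true_and, Sat,
    sat_hasType hsb, sat_hasType hsc]
  constructor
  · rintro ⟨h₁, t, rfl, hb, h₂⟩
    rw [sat_neqRange hsb fun i hi => hsf i (hi.trans_le (hd _))] at h₂
    refine ⟨hb, fun i hi => ?_⟩
    by_cases him : i < m₀
    · exact h₁ i (Nat.zero_le _) (by omega)
    · exact h₂ i (by omega) hi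
  · rintro ⟨hb, h⟩
    refine ⟨fun i _ hi => h i (by omega), M.typeOf c, rfl, hb, ?_⟩
    rw [sat_neqRange hsb fun i hi => hsf i (hi.trans_le (hd _))]
    exact fun i _ hi => h i hi

theorem exists_avoiding {M : UnaryModel τ n} {t : Finset τ} {r : ℕ} (hr : r < M.count t)
    (f : ℕ → Fin n) : ∃ b, M.typeOf b = t ∧ ∀ i < r, b ≠ f i := by
  have : ((Finset.range r).image f).card < (Finset.univ.filter fun a => M.typeOf a = t).card :=
    Finset.card_image_le.trans_lt (by simpa [count] using hr)
  obtain ⟨b, hb, hbf⟩ := Finset.exists_mem_notMem_of_card_lt_card this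
  refine ⟨b, by simpa using hb, fun i hi hbi => hbf ?_⟩
  exact Finset.mem_image.2 ⟨i, Finset.mem_range.2 hi, hbi.symm⟩

theorem lt_count_of_forall_avoiding [NeZero n] {M : UnaryModel τ n} {t : Finset τ} {r : ℕ}
    (h : ∀ f : ℕ → Fin n, ∃ b, M.typeOf b = t ∧ ∀ i < r, b ≠ f i) : r < M.count t := by
  by_contra! hr
  set S := Finset.univ.filter fun a => M.typeOf a = t with hS
  let e := S.equivFin
  obtain ⟨b, hb, hbf⟩ := h fun i => if hi : i < S.card then (e.symm ⟨i, hi⟩ : Fin n) else 0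
  have hbS : b ∈ S := by simpa [hS] using hb
  refine hbf (e ⟨b, hbS⟩) ((e ⟨b, hbS⟩).2.trans_le hr) ?_
  simp

theorem iso_of_count_le {M N : UnaryModel τ n} (h : ∀ t, M.count t ≤ N.count t) : N.Iso M := by
  refine iso_iff_count.2 fun t => ?_
  have := (Finset.sum_eq_sum_iff_of_le fun t _ => h t).1 (M.sum_count.trans N.sum_count.symm)
  exact (this t (Finset.mem_univ t)).symm

theorem definedBy_and [NeZero n] {M : UnaryModel τ n} {m m₀ : ℕ} {d : Finset τ → ℕ}
    (hm₀ : m₀ ≤ m) (hd : ∀ t, m₀ + d t ≤ m)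
    (hM : ∀ t, M.count t ≠ 0 → M.count t = m₀ + d t + 1) :
    M.DefinedBy (and (realizes {t | M.count t ≠ 0}) (avoids m m₀ d)) := by
  have hex : ∀ {N : UnaryModel τ n} {t : Finset τ}, N.count t ≠ 0 ↔ ∃ a, N.typeOf a = t := by
    intro N t
    rw [count, Finset.card_ne_zero]
    simp [Finset.Nonempty]
  refine ⟨?_, fun N => ?_⟩
  · rw [IsSentence, freeVars, isSentence_realizes, isSentence_avoids hm₀ hd, Finset.empty_union]
  · have : N.Models (and (realizes {t | M.count t ≠ 0}) (avoids m m₀ d)) ↔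
        N.Models (realizes {t | M.count t ≠ 0}) ∧ N.Models (avoids m m₀ d) := Iff.rfl
    rw [this, models_realizes, models_avoids hm₀ hd]
    constructor
    · rintro ⟨h₁, h₂⟩
      refine iso_of_count_le fun t => ?_
      by_cases ht : M.count t = 0
      · omega
      · obtain ⟨c, rfl⟩ := h₁ t (by simpa using ht)
        rw [hM _ ht]
        exact lt_count_of_forall_avoiding fun f => h₂ f c
    · intro h
      rw [iso_iff_count] at h
      refine ⟨fun t ht => ?_, fun f c => ?_⟩
      · rw [← hex, h]
        simpa using ht
      · have hc : N.count (N.typeOf c) ≠ 0 := hex.2 ⟨c, rfl⟩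
        refine exists_avoiding ?_ f
        rw [h] at hc ⊢
        have := hM _ hc
        omega

end UnaryModel

/-- The second moment of a sum of independent uniform samples of a centered bounded function. -/
theorem sum_sq_sum_le {A : Type*} [Fintype A] [DecidableEq A] {g : A → ℝ} (hg : ∑ a, g a = 0)
    (hg' : ∀ a, |g a| ≤ 1) (n : ℕ) :
    ∑ f : Fin n → A, (∑ i, g (f i)) ^ 2 ≤ n * (Fintype.card A : ℝ) ^ n := by
  induction n with
  | zero => simp
  | succ n ih =>
    have hstep : ∑ f : Fin (n + 1) → A, (∑ i, g (f i)) ^ 2 =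
        (Fintype.card A : ℝ) ^ n * ∑ a, g a ^ 2 +
          Fintype.card A * ∑ f : Fin n → A, (∑ i, g (f i)) ^ 2 := by
      rw [← (Fin.consEquiv fun _ => A).sum_comp, Fintype.sum_prod_type]
      have : ∀ (a : A) (f : Fin n → A), (∑ i, g (Fin.consEquiv (fun _ => A) (a, f) i)) ^ 2 =
          g a ^ 2 + g a * (2 * ∑ i, g (f i)) + (∑ i, g (f i)) ^ 2 := fun a f => by
        simp only [Fin.consEquiv_apply, Fin.sum_univ_succ, Fin.cons_zero, Fin.cons_succ]
        ring
      simp only [this, Finset.sum_add_distrib, ← Finset.mul_sum, ← Finset.sum_mul, hg]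
      simp [Finset.mul_sum]
    have hsq : ∑ a, g a ^ 2 ≤ Fintype.card A := by
      calc ∑ a, g a ^ 2 ≤ ∑ _a : A, (1 : ℝ) :=
            Finset.sum_le_sum fun a _ => (sq_le_one_iff_abs_le_one _).2 (hg' a)
        _ = Fintype.card A := by simp
    rw [hstep]
    calc _ ≤ (Fintype.card A : ℝ) ^ n * Fintype.card A +
          Fintype.card A * (n * (Fintype.card A : ℝ) ^ n) := by gcongr
      _ = _ := by push_cast; ring

theorem sum_abs_sum_le {A : Type*} [Fintype A] [DecidableEq A] {g : A → ℝ} (hg : ∑ a, g a = 0)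
    (hg' : ∀ a, |g a| ≤ 1) (n : ℕ) :
    ∑ f : Fin n → A, |∑ i, g (f i)| ≤ (Fintype.card A : ℝ) ^ n * √n := by
  refine abs_le_of_sq_le_sq' ?_ (by positivity) |>.2
  refine sq_sum_le_card_mul_sum_sq.trans ?_
  simp only [sq_abs, Finset.card_univ, Fintype.card_fun, Fintype.card_fin, Nat.cast_pow]
  calc _ ≤ (Fintype.card A : ℝ) ^ n * (n * (Fintype.card A : ℝ) ^ n) := by
        gcongr
        exact sum_sq_sum_le hg hg' n
    _ = _ := by rw [mul_pow, Real.sq_sqrt (by positivity)]; ring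

namespace UnaryModel

variable {τ : Type*} [Fintype τ] [DecidableEq τ] {n : ℕ}

/-- A model is determined by the types of its elements. -/
def typeEquiv (τ : Type*) [Fintype τ] [DecidableEq τ] (n : ℕ) :
    UnaryModel τ n ≃ (Fin n → Finset τ) where
  toFun := typeOf
  invFun f P := {a | P ∈ f a}
  left_inv M := by
    ext P a
    simp [mem_typeOf]
  right_inv f := by
    ext a P
    simp [mem_typeOf]

theorem sum_abs_count_sub_le (t : Finset τ) :
    ∑ M : UnaryModel τ n, |(M.count t : ℝ) - n / 2 ^ Fintype.card τ| ≤
      ((2 : ℝ) ^ Fintype.card τ) ^ n * √n := by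
  set T : ℝ := 2 ^ Fintype.card τ with hT
  have hT1 : 1 ≤ T := one_le_pow₀ (by norm_num)
  have hT0 : T ≠ 0 := by positivity
  let g : Finset τ → ℝ := fun u => (if u = t then 1 else 0) - 1 / T
  have hg : ∑ u, g u = 0 := by
    simp only [g, Finset.sum_sub_distrib, Finset.sum_ite_eq', Finset.mem_univ, if_true,
      Finset.sum_const, Finset.card_univ, Fintype.card_finset, nsmul_eq_mul]
    push_cast
    rw [← hT, mul_one_div_cancel hT0, sub_self]
  have hg' : ∀ u, |g u| ≤ 1 := fun u => by
    have h₁ : 0 < 1 / T := by positivity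
    have h₂ : 1 / T ≤ 1 := (div_le_one (by positivity)).2 hT1
    simp only [g]
    split_ifs <;> rw [abs_le] <;> constructor <;> linarith
  have hsum : ∀ M : UnaryModel τ n, ∑ i, g (typeEquiv τ n M i) = (M.count t : ℝ) - n / T :=
    fun M => by
      simp [g, typeEquiv, count, Finset.sum_sub_distrib, div_eq_mul_inv]
  have := sum_abs_sum_le hg hg' n
  rw [← (typeEquiv τ n).sum_comp] at this
  simpa only [hsum, Fintype.card_finset, Nat.cast_pow, Nat.cast_ofNat] using this

/-- The description complexity is determined by the smallest and the largest count, up to their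
difference and a constant. -/
theorem descriptionComplexity_bounds [Nonempty τ] [NeZero n] (M : UnaryModel τ n) {lo hi : ℕ}
    (hlo : ∀ t, lo ≤ M.count t) (hhi : ∀ t, M.count t ≤ hi) :
    3 * (lo - 1) ≤ M.descriptionComplexity ∧
      M.descriptionComplexity ≤ 3 * hi + 2 * (2 ^ Fintype.card τ * (hi - lo)) +
        (10 + 2 ^ Fintype.card τ * (13 + 6 * Fintype.card τ)) := by
  have hlohi : lo ≤ hi := (hlo ∅).trans (hhi ∅)
  have hdef := definedBy_and (M := M) (m := hi) (m₀ := lo - 1)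
    (d := fun t => M.count t - 1 - (lo - 1)) (by omega)
    (fun t => by have := hlo t; have := hhi t; omega)
    (fun t ht => by have := hlo t; omega)
  constructor
  · refine le_csInf ⟨_, _, hdef, rfl⟩ ?_
    rintro _ ⟨φ, hφ, rfl⟩
    rcases Nat.eq_zero_or_pos lo with rfl | hpos
    · simp
    · exact hφ.three_mul_le_size fun t => by have := hlo t; omega
  · have hle : M.descriptionComplexity ≤ _ := Nat.sInf_le ⟨_, hdef, rfl⟩
    refine hle.trans ?_
    have h₁ := FOFormula.size_realizes_le {t | M.count t ≠ 0}
    have h₂ : ∑ t, (9 + 4 * Fintype.card τ + 2 * (M.count t - 1 - (lo - 1))) ≤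
        2 ^ Fintype.card τ * (9 + 4 * Fintype.card τ + 2 * (hi - lo)) := by
      calc _ ≤ ∑ _t : Finset τ, (9 + 4 * Fintype.card τ + 2 * (hi - lo)) :=
            Finset.sum_le_sum fun t _ => by have := hhi t; omega
        _ = _ := by simp
    rw [FOFormula.size, FOFormula.size_avoids]
    have h₃ : 2 ^ Fintype.card τ * (4 + 2 * Fintype.card τ) +
        2 ^ Fintype.card τ * (9 + 4 * Fintype.card τ + 2 * (hi - lo)) =
        2 * (2 ^ Fintype.card τ * (hi - lo)) +
          2 ^ Fintype.card τ * (13 + 6 * Fintype.card τ) := by ring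
    omega

/-- The description complexity is close to `3n / 2 ^ |τ|` for models with nearly equal counts. -/
theorem abs_descriptionComplexity_sub_le (τ : Type*) [Fintype τ] [DecidableEq τ] [Nonempty τ] :
    ∃ K : ℝ, 0 ≤ K ∧ ∀ (n : ℕ) [NeZero n] (M : UnaryModel τ n),
      |(M.descriptionComplexity : ℝ) - 3 * n / 2 ^ Fintype.card τ| ≤
        K * (1 + ∑ t, |(M.count t : ℝ) - n / 2 ^ Fintype.card τ|) := by
  set T : ℝ := 2 ^ Fintype.card τ with hT
  have hT1 : 1 ≤ T := one_le_pow₀ (by norm_num)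
  set c : ℝ := 10 + T * (13 + 6 * Fintype.card τ) with hc
  have hc0 : 0 ≤ c := by positivity
  refine ⟨3 + 4 * T + c, by positivity, fun n _ M => ?_⟩
  set D := ∑ t, |(M.count t : ℝ) - n / T| with hD
  have hD0 : 0 ≤ D := Finset.sum_nonneg fun _ _ => abs_nonneg _
  have hcount : ∀ t, |(M.count t : ℝ) - n / T| ≤ D := fun t =>
    Finset.single_le_sum (f := fun t => |(M.count t : ℝ) - n / T|)
      (fun _ _ => abs_nonneg _) (Finset.mem_univ t)
  obtain ⟨u, -, hu⟩ := Finset.exists_min_image Finset.univ M.count ⟨∅, Finset.mem_univ _⟩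
  obtain ⟨v, -, hv⟩ := Finset.exists_max_image Finset.univ M.count ⟨∅, Finset.mem_univ _⟩
  obtain ⟨h₁, h₂⟩ := M.descriptionComplexity_bounds (fun t => hu t (Finset.mem_univ t))
    (fun t => hv t (Finset.mem_univ t))
  have huD := abs_le.1 (hcount u)
  have hvD := abs_le.1 (hcount v)
  have h₁' : 3 * ((M.count u : ℝ) - 1) ≤ M.descriptionComplexity := by
    have : M.count u ≤ (M.count u - 1) + 1 := by omega
    have : (M.count u : ℝ) ≤ (M.count u - 1 : ℕ) + 1 := by exact_mod_cast this
    have : 3 * ((M.count u - 1 : ℕ) : ℝ) ≤ M.descriptionComplexity := by exact_mod_cast h₁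
    linarith
  have h₂' : (M.descriptionComplexity : ℝ) ≤
      3 * M.count v + 2 * (T * ((M.count v : ℝ) - M.count u)) + c := by
    have := (Nat.cast_le (α := ℝ)).2 h₂
    push_cast [Nat.cast_sub (hu v (Finset.mem_univ v))] at this
    exact this
  have hTD : T * ((M.count v : ℝ) - M.count u) ≤ T * (2 * D) :=
    mul_le_mul_of_nonneg_left (by linarith) (by linarith)
  have h3 : 3 * (n : ℝ) / T = 3 * (n / T) := by ring
  have hTD0 : 0 ≤ T * D := by positivity
  have hcD0 : 0 ≤ c * D := by positivity
  rw [h3, abs_le]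
  constructor <;> nlinarith

end UnaryModel

theorem abs_expectedComplexity_sub_le (τ : Type*) [Fintype τ] [DecidableEq τ] [Nonempty τ] :
    ∃ K : ℝ, ∀ n : ℕ, 0 < n →
      |expectedComplexity τ n - 3 * n / 2 ^ Fintype.card τ| ≤ K * √n := by
  obtain ⟨K, hK, h⟩ := UnaryModel.abs_descriptionComplexity_sub_le τ
  set T : ℝ := 2 ^ Fintype.card τ with hT
  have hT0 : 0 < T := by positivity
  refine ⟨K * (1 + T), fun n hn => ?_⟩
  have : NeZero n := ⟨hn.ne'⟩
  have hcard : ∑ _M : UnaryModel τ n, (1 : ℝ) = T ^ n := by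
    rw [← (UnaryModel.typeEquiv τ n).symm.sum_comp]
    simp [hT]
  have hn1 : 1 ≤ √(n : ℝ) := Real.one_le_sqrt.2 (by exact_mod_cast hn)
  have hpow : (2 : ℝ) ^ (Fintype.card τ * n) = T ^ n := by rw [pow_mul]
  have hE : expectedComplexity τ n - 3 * n / T =
      1 / T ^ n * ∑ M : UnaryModel τ n, ((M.descriptionComplexity : ℝ) - 3 * n / T) := by
    have : ∑ _M : UnaryModel τ n, (3 * n / T : ℝ) = T ^ n * (3 * n / T) := by
      rw [← hcard, Finset.sum_mul]
      simp
    rw [expectedComplexity, hpow, Finset.sum_sub_distrib, this, mul_sub, ← mul_assoc (1 / T ^ n),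
      one_div_mul_cancel (by positivity), one_mul]
  rw [hE, abs_mul, abs_of_pos (by positivity : 0 < 1 / T ^ n), one_div,
    inv_mul_le_iff₀ (by positivity)]
  calc |∑ M : UnaryModel τ n, ((M.descriptionComplexity : ℝ) - 3 * n / T)|
      ≤ ∑ M : UnaryModel τ n, |(M.descriptionComplexity : ℝ) - 3 * n / T| :=
        Finset.abs_sum_le_sum_abs _ _
    _ ≤ ∑ M : UnaryModel τ n, K * (1 + ∑ t, |(M.count t : ℝ) - n / T|) :=
        Finset.sum_le_sum fun M _ => h n M
    _ = K * (T ^ n + ∑ t, ∑ M : UnaryModel τ n, |(M.count t : ℝ) - n / T|) := by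
        rw [← Finset.mul_sum, Finset.sum_add_distrib, hcard, Finset.sum_comm]
    _ ≤ K * (T ^ n * √n + ∑ _t : Finset τ, T ^ n * √n) := by
        gcongr
        · exact le_mul_of_one_le_right (by positivity) hn1
        · exact UnaryModel.sum_abs_count_sub_le _
    _ = T ^ n * (K * (1 + T) * √n) := by
        simp only [Finset.sum_const, Finset.card_univ, Fintype.card_finset, nsmul_eq_mul,
          Nat.cast_pow, Nat.cast_ofNat, ← hT]
        ring

theorem mainTheorem3 (τ : Type*) [Fintype τ] [DecidableEq τ] [Nonempty τ] :
    (fun n : ℕ => expectedComplexity τ n) ~[atTop]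
      (fun n : ℕ => 3 * (n : ℝ) / 2 ^ Fintype.card τ) := by
  obtain ⟨K, hK⟩ := abs_expectedComplexity_sub_le τ
  have h₁ : (fun n : ℕ => expectedComplexity τ n - 3 * (n : ℝ) / 2 ^ Fintype.card τ) =O[atTop]
      fun n : ℕ => √(n : ℝ) := by
    refine IsBigO.of_bound K ?_
    filter_upwards [eventually_gt_atTop 0] with n hn
    rw [Real.norm_eq_abs, Real.norm_of_nonneg (Real.sqrt_nonneg _)]
    exact hK n hn
  have h₂ : (fun n : ℕ => √(n : ℝ)) =o[atTop] fun n : ℕ => (n : ℝ) := by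
    have : (fun _ : ℕ => (1 : ℝ)) =o[atTop] fun n : ℕ => √(n : ℝ) := by
      rw [isLittleO_one_left_iff]
      exact tendsto_norm_atTop_atTop.comp
        (Real.tendsto_sqrt_atTop.comp tendsto_natCast_atTop_atTop)
    simpa only [one_mul, Real.mul_self_sqrt (Nat.cast_nonneg _)] using
      this.mul_isBigO (isBigO_refl (fun n : ℕ => √(n : ℝ)) atTop)
  have h₃ : (fun n : ℕ => (n : ℝ)) =O[atTop]
      fun n : ℕ => 3 * (n : ℝ) / 2 ^ Fintype.card τ := by
    have : (fun n : ℕ => 3 * (n : ℝ) / 2 ^ Fintype.card τ) =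
        fun n : ℕ => (3 / 2 ^ Fintype.card τ) * (n : ℝ) := by
      funext n
      ring
    rw [this]
    exact (isBigO_refl _ _).const_mul_right (by positivity)
  exact (h₁.trans_isLittleO h₂).trans_isBigO h₃
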